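/- Let $\mathcal M$ be a von Neumann algebra on a complex Hilbert space, with a faithful normal semifinite trace $\tau$ on its positive cone. Let $T$ be a (possibly unbounded) self-adjoint operator affiliated with $\mathcal M$, with $\tau$-compact resolvent: for some (equivalently, every) $z$ in the resolvent set of $T$, $(T-z)^{-1}$ is a norm limit of elements of $\mathcal M$ whose range projection has finite trace. Let $C\in\mathcal M$ be self-adjoint. For a self-adjoint operator $S$ affiliated with $\mathcal M$ and $s>0$ put $\zeta_S(s)=\tau\big((S^2+1)^{-s/2}\big)\in[0,\infty]$. For real numbers $d\ge 0$ and $\alpha$, say that $\operatorname{res}_{s=d}\zeta_S(s)$ exists and equals $\alpha$ if $\zeta_S(s)<\infty$ for all $s>d$ and $\lim_{s\to d^+}(s-d)\,\zeta_S(s)=\alpha$. Then, for all real $d\ge 0$ and $\alpha$, the following are equivalent: (1) $\operatorname{res}_{s=d}\tau\big((T^2+1)^{-s/2}\big)$ exists and equals $\alpha$; (2) $\operatorname{res}_{s=d}\tau\big(((T+C)^2+1)^{-s/2}\big)$ exists and equals $\alpha$. Moreover the abscissas of convergence of the two functions coincide: $$\inf\{s>0:\zeta_T(s)<\infty\}=\inf\{s>0:\zeta_{T+C}(s)<\infty\}$$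 (with $\inf\emptyset=+\infty$). -/

import Mathlib

open scoped ENNReal NNReal

namespace Semifinite

noncomputable section

/-! ### Unbounded operators -/

section Operators

variable {H : Type*} [NormedAddCommGroup H] [InnerProductSpace ℂ H]

/-- The perturbation `T + C` of an unbounded operator `T` by a bounded operator `C`;
its domain is the domain of `T`. -/
def addBounded (T : H →ₗ.[ℂ] H) (C : H →L[ℂ] H) : H →ₗ.[ℂ] H :=
  (C : H →ₗ[ℂ] H) +ᵥ T

/-- The operator `T ^ 2`, with its natural domain `{x ∈ dom T | T x ∈ dom T}`. -/
def sq (T : H →ₗ.[ℂ] H) : H →ₗ.[ℂ] H :=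
  T.comp (T.domRestrict ((T.domain.comap T.toFun).map T.domain.subtype)) (by
    rintro ⟨x, hx⟩
    obtain ⟨⟨y, hy, rfl⟩, hx'⟩ := hx
    exact hy)

/-- The operator `T ^ 2 + 1`. -/
def sqAddOne (T : H →ₗ.[ℂ] H) : H →ₗ.[ℂ] H :=
  addBounded (sq T) 1

/-- `B` is the bounded, everywhere defined inverse of the unbounded operator `A`: `A` is a
bijection from its domain onto `H`, with inverse `B`. -/
def IsBoundedInverse (A : H →ₗ.[ℂ] H) (B : H →L[ℂ] H) : Prop :=
  ∀ x y : H, (x, y) ∈ A.graph ↔ B y = x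

open Classical in
/-- The bounded inverse `A⁻¹` of an unbounded operator `A` that has one (and `0` otherwise). -/
def boundedInverse (A : H →ₗ.[ℂ] H) : H →L[ℂ] H :=
  if h : ∃ B, IsBoundedInverse A B then h.choose else 0

theorem IsBoundedInverse.boundedInverse_eq {A : H →ₗ.[ℂ] H} {B : H →L[ℂ] H}
    (hB : IsBoundedInverse A B) : boundedInverse A = B := by
  have h : ∃ B, IsBoundedInverse A B := ⟨B, hB⟩
  ext y
  rw [boundedInverse, dif_pos h]
  exact (h.choose_spec _ y).1 ((hB _ y).2 rfl)

theorem mem_graph_sqAddOne {T : H →ₗ.[ℂ] H} {x y : H} :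
    (x, y) ∈ (sqAddOne T).graph ↔ ∃ z, (x, z) ∈ T.graph ∧ (z, y - x) ∈ T.graph := by
  simp only [LinearPMap.mem_graph_iff]
  constructor
  · rintro ⟨⟨x', hx'⟩, rfl, hy⟩
    obtain ⟨⟨u, hu, rfl⟩, hx⟩ := hx'
    refine ⟨T u, ⟨u, rfl, rfl⟩, ⟨⟨T u, hu⟩, rfl, ?_⟩⟩
    rw [eq_sub_iff_add_eq, add_comm]
    exact hy
  · rintro ⟨z, ⟨u, rfl, rfl⟩, ⟨v, hv, hy⟩⟩
    have hu : T u ∈ T.domain := hv ▸ v.2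
    refine ⟨⟨(u : H), ⟨⟨u, hu, rfl⟩, u.2⟩⟩, rfl, ?_⟩
    have hv' : v = ⟨T u, hu⟩ := Subtype.ext hv
    rw [hv', eq_sub_iff_add_eq, add_comm] at hy
    exact hy

/-- For self-adjoint `T` the operator `T ^ 2 + 1` has a bounded inverse. -/
theorem exists_isBoundedInverse_sqAddOne [CompleteSpace H] {T : H →ₗ.[ℂ] H}
    (hT : IsSelfAdjoint T) : ∃ B, IsBoundedInverse (sqAddOne T) B := by
  have hadj : T.graph.adjoint = T.graph := by
    rw [← LinearPMap.adjoint_graph_eq_graph_adjoint hT.dense_domain,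
      LinearPMap.isSelfAdjoint_def.1 hT]
  have hsymm : ∀ a b c d : H, (a, b) ∈ T.graph → (c, d) ∈ T.graph →
      inner ℂ b c = inner ℂ a d := by
    intro a b c d h1 h2
    rw [← hadj, Submodule.mem_adjoint_iff] at h2
    exact sub_eq_zero.1 (h2 a b h1)
  let e := WithLp.linearEquiv 2 ℂ (H × H)
  let G : Submodule ℂ (WithLp 2 (H × H)) := T.graph.comap e.toLinearMap
  have hGc : IsClosed (G : Set (WithLp 2 (H × H))) :=
    hT.isClosed.preimage (WithLp.prod_continuous_ofLp 2 H H)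
  have : CompleteSpace G := hGc.completeSpace_coe
  let E := WithLp.prodContinuousLinearEquiv 2 ℂ H H
  let B : H →L[ℂ] H := (ContinuousLinearMap.fst ℂ H H).comp
    ((E : WithLp 2 (H × H) →L[ℂ] H × H).comp
      ((G.starProjection).comp ((E.symm : H × H →L[ℂ] WithLp 2 (H × H)).comp
        (ContinuousLinearMap.inl ℂ H H))))
  have huniq : ∀ x y : H, (x, y) ∈ (sqAddOne T).graph → y = 0 → x = 0 := by
    rintro x y h rfl
    obtain ⟨z, h1, h2⟩ := mem_graph_sqAddOne.1 h
    have h3 := hsymm x z z _ h1 h2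
    rw [zero_sub, inner_neg_right, inner_self_eq_norm_sq_to_K, inner_self_eq_norm_sq_to_K] at h3
    have h4 : ‖z‖ ^ 2 = -‖x‖ ^ 2 := by exact_mod_cast h3
    have h5 : ‖x‖ ^ 2 = 0 := by nlinarith [sq_nonneg ‖z‖, sq_nonneg ‖x‖]
    simpa using h5
  have hB : ∀ y, (B y, y) ∈ (sqAddOne T).graph := by
    intro y
    let w : WithLp 2 (H × H) := WithLp.toLp 2 (y, 0)
    let p := G.starProjection w
    have hBp : B y = p.fst := rfl
    have hp : (p.fst, p.snd) ∈ T.graph := G.starProjection_apply_mem w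
    have hq : ∀ a b : H, (a, b) ∈ T.graph →
        inner ℂ a (y - p.fst) - inner ℂ b p.snd = 0 := by
      intro a b hab
      have h'' : inner ℂ a (y - p.fst) + inner ℂ b (0 - p.snd) = 0 :=
        G.inner_right_of_mem_orthogonal (u := WithLp.toLp 2 (a, b)) (v := w - p) hab
          (G.sub_starProjection_mem_orthogonal w)
      rwa [zero_sub, inner_neg_right, ← sub_eq_add_neg] at h''
    rw [hBp, mem_graph_sqAddOne]
    refine ⟨p.snd, hp, ?_⟩
    rw [← hadj, Submodule.mem_adjoint_iff]
    intro a b hab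
    have := hq a b hab
    rw [← neg_sub, this, neg_zero]
  refine ⟨B, fun x y => ⟨fun h => ?_, fun h => h ▸ hB y⟩⟩
  have h0 := (sqAddOne T).graph.sub_mem (hB y) h
  exact sub_eq_zero.1 (huniq _ _ h0 (sub_self y))

end Operators

/-! ### Traces on von Neumann algebras -/

section Traces

variable {H : Type*} [NormedAddCommGroup H] [InnerProductSpace ℂ H] [CompleteSpace H]

/-- `τ` is a faithful normal semifinite trace on the von Neumann algebra `M`. A trace is a map
from the positive cone of `M` to `[0, ∞]`; the values of `τ` at other operators play no role. -/
structure IsFNSTrace (M : VonNeumannAlgebra H) (τ : (H →L[ℂ] H) → ℝ≥0∞) : Prop where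
  map_add : ∀ x ∈ M, ∀ y ∈ M, 0 ≤ x → 0 ≤ y → τ (x + y) = τ x + τ y
  map_smul : ∀ (c : ℝ≥0), ∀ x ∈ M, 0 ≤ x → τ ((c : ℝ) • x) = c * τ x
  tracial : ∀ x ∈ M, τ (star x * x) = τ (x * star x)
  faithful : ∀ x ∈ M, 0 ≤ x → τ x = 0 → x = 0
  normal : ∀ D : Set (H →L[ℂ] H), D.Nonempty → DirectedOn (· ≤ ·) D →
    (∀ y ∈ D, y ∈ M ∧ 0 ≤ y) → ∀ x ∈ M, IsLUB D x → τ x = ⨆ y ∈ D, τ y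
  semifinite : ∀ x ∈ M, 0 ≤ x → x ≠ 0 → ∃ y ∈ M, 0 ≤ y ∧ y ≤ x ∧ y ≠ 0 ∧ τ y ≠ ∞

/-- The unbounded operator `T` is affiliated with `M`: `y T ⊆ T y` for all `y` in the
commutant of `M`. -/
def IsAffiliated (M : VonNeumannAlgebra H) (T : H →ₗ.[ℂ] H) : Prop :=
  ∀ y ∈ M.commutant, ∀ x z : H, (x, z) ∈ T.graph → (y x, y z) ∈ T.graph

/-- The elements of `M` of finite `τ`-rank: those whose range lies in the range of a projection
of `M` of finite trace. -/
def finiteRank (M : VonNeumannAlgebra H) (τ : (H →L[ℂ] H) → ℝ≥0∞) : Set (H →L[ℂ] H) :=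
  {x | x ∈ M ∧ ∃ p ∈ M, IsStarProjection p ∧ τ p ≠ ∞ ∧ p * x = x}

/-- `x` is `τ`-compact: it is a norm limit of elements of `M` of finite `τ`-rank. -/
def IsTauCompact (M : VonNeumannAlgebra H) (τ : (H →L[ℂ] H) → ℝ≥0∞) (x : H →L[ℂ] H) : Prop :=
  x ∈ closure (finiteRank M τ)

/-- `T` has `τ`-compact resolvent: `(T - z)⁻¹` is `τ`-compact for some point `z` of the resolvent
set (equivalently, by the resolvent identity, for every such point). -/
def HasTauCompactResolvent (M : VonNeumannAlgebra H) (τ : (H →L[ℂ] H) → ℝ≥0∞)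
    (T : H →ₗ.[ℂ] H) : Prop :=
  ∃ (z : ℂ) (B : H →L[ℂ] H),
    IsBoundedInverse (addBounded T (-(z • (1 : H →L[ℂ] H)))) B ∧ IsTauCompact M τ B

/-- The function `s ↦ τ ((T ^ 2 + 1) ^ (-s / 2))`, for `s > 0`. The power is the
power `s / 2`, in the continuous functional calculus, of the bounded positive operator
`(T ^ 2 + 1)⁻¹`. -/
def zeta (τ : (H →L[ℂ] H) → ℝ≥0∞) (T : H →ₗ.[ℂ] H) (s : ℝ) : ℝ≥0∞ :=
  τ (boundedInverse (sqAddOne T) ^ (s / 2))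

end Traces

/-! ### Residues and abscissas of convergence -/

/-- The residue of `f` at `d` exists and is the real number `a`: the function is finite to the
right of `d` and `(s - d) f(s) → a` as `s → d+`. -/
def HasResidue (f : ℝ → ℝ≥0∞) (d a : ℝ) : Prop :=
  (∀ s, d < s → f s ≠ ∞) ∧
    Filter.Tendsto (fun s => (s - d) * (f s).toReal) (nhdsWithin d (Set.Ioi d)) (nhds a)

/-- The abscissa of convergence `inf {s > 0 | f(s) < ∞}`, which is `∞` if there is no such `s`. -/
def abscissa (f : ℝ → ℝ≥0∞) : EReal :=
  sInf ((fun s : ℝ => (s : EReal)) '' {s : ℝ | 0 < s ∧ f s ≠ ∞})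

end

end Semifinite

/-! Put A = (T² + 1)⁻¹ and B = ((T + C)² + 1)⁻¹. For every ε > 0, expanding ‖(T + C)x‖² gives the
form inequality (T + C)² + 1 ≤ (1 + ε)(T² + 1) + k with k = (1 + ε⁻¹)‖C‖². Inversion reverses it:
g(A) ≤ B, where g(x) = x / (1 + ε + kx) (`moebius_le_of_isBoundedInverse`). Although t ↦ t^p is not
operator monotone for p > 1, its trace is monotone (`IsFNSTrace.rpow_le_rpow`), so τ(g(A)^p) ≤
τ(B^p) for all p ≥ 0.

Near 0, x is at most (1 + 2ε) g(x); away from 0, x^p is at most a constant times x^q, uniformly in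
p. Hence, if ζ_T(q) is finite for one q, then ζ_T(s) ≤ N + (1 + ε)^s ζ_{T+C}(s) with N independent
of s (`zeta_le_add_mul_zeta_addBounded`). Multiplication by s - d kills N as s → d+, and ε → 0
removes the factor. Since T = (T + C) - C, the reverse estimate also holds, so the residues agree. A
cruder bound with ε = 1 and no additive term shows that both functions are finite at the same
points. -/

namespace Semifinite

/-! ### Functional calculus: intertwining and real powers -/

section CStar

variable {A : Type*} [CStarAlgebra A]

/-- The continuous functional calculus respects intertwining relations. -/
theorem mul_cfc_eq_cfc_mul {a b w : A} (ha : IsSelfAdjoint a) (hb : IsSelfAdjoint b)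
    (h : w * a = b * w) {f : ℝ → ℝ} (hf : Continuous f) : w * cfc f a = cfc f b * w := by
  -- Both calculi are defined on functions on one compact set containing the two spectra, so
  -- Stone–Weierstrass induction treats `a` and `b` simultaneously.
  have hsa : spectrum ℝ a ⊆ spectrum ℝ a ∪ spectrum ℝ b := Set.subset_union_left
  have hsb : spectrum ℝ b ⊆ spectrum ℝ a ∪ spectrum ℝ b := Set.subset_union_right
  have hcomp : CompactSpace (spectrum ℝ a ∪ spectrum ℝ b : Set ℝ) :=
    isCompact_iff_compactSpace.1
      ((ContinuousFunctionalCalculus.isCompact_spectrum a).union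
        (ContinuousFunctionalCalculus.isCompact_spectrum b))
  have key : ∀ g : C((spectrum ℝ a ∪ spectrum ℝ b : Set ℝ), ℝ),
      w * cfcHomSuperset ha hsa g = cfcHomSuperset hb hsb g * w := by
    intro g
    induction g using ContinuousMap.induction_on_of_compact with
    | const r =>
      have : ContinuousMap.const (spectrum ℝ a ∪ spectrum ℝ b : Set ℝ) r =
        algebraMap ℝ C((spectrum ℝ a ∪ spectrum ℝ b : Set ℝ), ℝ) r := rfl
      rw [this, AlgHomClass.commutes, AlgHomClass.commutes, Algebra.commutes]
    | id => rwa [cfcHomSuperset_id, cfcHomSuperset_id]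
    | star_id => rwa [map_star, map_star, cfcHomSuperset_id, cfcHomSuperset_id, ha.star_eq,
        hb.star_eq]
    | add f g hf hg => rw [map_add, map_add, mul_add, add_mul, hf, hg]
    | mul f g hf hg => rw [map_mul, map_mul, ← mul_assoc, hf, mul_assoc, hg, mul_assoc]
    | frequently f hf =>
      exact hf.mem_of_closed <| isClosed_eq
        (continuous_const.mul (cfcHomSuperset_continuous ha hsa))
        ((cfcHomSuperset_continuous hb hsb).mul continuous_const)
  have := key ⟨fun x => f x, by fun_prop⟩
  rw [cfc_apply f a, cfc_apply f b]
  exact this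

variable [PartialOrder A] [StarOrderedRing A]

theorem rpow_add_of_nonneg (a : A) {x y : ℝ} (hx : 0 ≤ x) (hy : 0 ≤ y) :
    a ^ (x + y) = a ^ x * a ^ y := by
  simp only [CFC.rpow_def]
  rw [← cfc_mul _ _ a (NNReal.continuous_rpow_const hx).continuousOn
    (NNReal.continuous_rpow_const hy).continuousOn]
  exact cfc_congr fun z _ => NNReal.rpow_add_of_nonneg z hx hy

theorem rpow_half_mul_self (a : A) {p : ℝ} (hp : 0 ≤ p) : a ^ (p / 2) * a ^ (p / 2) = a ^ p := by
  rw [← rpow_add_of_nonneg a (by positivity) (by positivity), add_halves]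

theorem star_rpow (a : A) (p : ℝ) : star (a ^ p) = a ^ p :=
  (CFC.rpow_nonneg (a := a) (y := p)).isSelfAdjoint.star_eq

theorem mul_rpow_star_mul_self (w : A) {p : ℝ} (hp : 0 ≤ p) :
    w * (star w * w) ^ p = (w * star w) ^ p * w := by
  rw [CFC.rpow_eq_cfc_real (star_mul_self_nonneg w), CFC.rpow_eq_cfc_real (mul_star_self_nonneg w)]
  exact mul_cfc_eq_cfc_mul (.star_mul_self w) (.mul_star_self w) (mul_assoc _ _ _).symm
    (Real.continuous_rpow_const hp)

theorem cfc_rpow_of_nonneg {a : A} (ha : IsSelfAdjoint a) {f : ℝ → ℝ} {p : ℝ} (hp : 0 ≤ p)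
    (hf : ContinuousOn f (spectrum ℝ a)) (hf0 : ∀ x ∈ spectrum ℝ a, 0 ≤ f x) :
    cfc f a ^ p = cfc (fun x => f x ^ p) a := by
  rw [CFC.rpow_eq_cfc_real (cfc_nonneg hf0),
    ← cfc_comp' _ _ a (Real.continuous_rpow_const hp).continuousOn]

end CStar

/-! ### Monotonicity of x ↦ τ(x^p) -/

section Trace

variable {H : Type*} [NormedAddCommGroup H] [InnerProductSpace ℂ H] [CompleteSpace H]
  {M : VonNeumannAlgebra H} {τ : (H →L[ℂ] H) → ℝ≥0∞}

theorem mem_of_commute {a : H →L[ℂ] H} (h : ∀ y ∈ M.commutant, Commute a y) : a ∈ M := by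
  rw [← VonNeumannAlgebra.commutant_commutant M, VonNeumannAlgebra.mem_commutant_iff]
  exact fun y hy => (h y hy).symm

theorem commute_of_mem {a y : H →L[ℂ] H} (ha : a ∈ M) (hy : y ∈ M.commutant) : Commute a y :=
  VonNeumannAlgebra.mem_commutant_iff.1 hy a ha

theorem cfc_mem {a : H →L[ℂ] H} (ha : a ∈ M) (f : ℝ → ℝ) : cfc f a ∈ M :=
  mem_of_commute fun _ hy => (commute_of_mem ha hy).cfc_real f

theorem rpow_mem {a : H →L[ℂ] H} (ha : a ∈ M) (p : ℝ) : a ^ p ∈ M :=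
  mem_of_commute fun _ hy => (commute_of_mem ha hy).cfc_nnreal _

namespace IsFNSTrace

variable (hτ : IsFNSTrace M τ) {x y : H →L[ℂ] H}
include hτ

theorem mono (hx : x ∈ M) (hy : y ∈ M) (hx0 : 0 ≤ x) (hxy : x ≤ y) : τ x ≤ τ y := by
  have h := hτ.map_add x hx (y - x) (sub_mem hy hx) hx0 (sub_nonneg.2 hxy)
  rw [add_sub_cancel] at h
  exact h ▸ le_self_add

/-- Traciality applied to w (w*w)^((p-1)/2). The intertwining of w*w and ww* by w takes the place of
a polar decomposition. -/
theorem rpow_mul_star_self {w : H →L[ℂ] H} (hw : w ∈ M) {p : ℝ} (hp : 1 ≤ p) :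
    τ ((w * star w) ^ p) = τ ((star w * w) ^ p) := by
  have hp0 : 0 ≤ p - 1 := sub_nonneg.2 hp
  have hsw : star w * w ∈ M := mul_mem (star_mem hw) hw
  have h := hτ.tracial (w * (star w * w) ^ ((p - 1) / 2)) (mul_mem hw (rpow_mem hsw _))
  have e : p = (p - 1) / 2 + 1 + (p - 1) / 2 := by ring
  have e' : p = (p - 1) + 1 := by ring
  have h1 : star (w * (star w * w) ^ ((p - 1) / 2)) * (w * (star w * w) ^ ((p - 1) / 2)) =
      (star w * w) ^ p := by
    conv_rhs => rw [e, rpow_add_of_nonneg _ (by positivity) (by positivity),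
      rpow_add_of_nonneg _ (by positivity) (by positivity), CFC.rpow_one _ (star_mul_self_nonneg w)]
    rw [star_mul, star_rpow]
    noncomm_ring
  have h2 : w * (star w * w) ^ ((p - 1) / 2) * star (w * (star w * w) ^ ((p - 1) / 2)) =
      (w * star w) ^ p := by
    conv_rhs => rw [e', rpow_add_of_nonneg _ (by positivity) (by positivity),
      CFC.rpow_one _ (mul_star_self_nonneg w), ← mul_assoc, ← mul_rpow_star_mul_self _ hp0,
      ← rpow_half_mul_self _ hp0]
    rw [star_mul, star_rpow]
    noncomm_ring
  rw [← h1, ← h2, h]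

/-- Only one factor of x is replaced at a time: first the middle factor in x^((p-1)/2) x
x^((p-1)/2), then, after a cyclic move under τ, the power x^(p-1). The latter is legitimate by
Löwner–Heinz because p - 1 ≤ 1. -/
theorem rpow_le_rpow_of_le_two (hx : x ∈ M) (hy : y ∈ M) (hx0 : 0 ≤ x) (hxy : x ≤ y) {p : ℝ}
    (hp : 1 ≤ p) (hp2 : p ≤ 2) : τ (x ^ p) ≤ τ (y ^ p) := by
  have hy0 : 0 ≤ y := hx0.trans hxy
  have hp0 : 0 ≤ p - 1 := sub_nonneg.2 hp
  have e : p = (p - 1) / 2 + 1 + (p - 1) / 2 := by ring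
  have e' : p = 1 / 2 + (p - 1) + 1 / 2 := by ring
  have hsq : y ^ (1 / 2 : ℝ) * y ^ (1 / 2 : ℝ) = y := by
    rw [rpow_half_mul_self _ zero_le_one, CFC.rpow_one _ hy0]
  calc τ (x ^ p) = τ (x ^ ((p - 1) / 2) * x * x ^ ((p - 1) / 2)) := by
        conv_lhs => rw [e, rpow_add_of_nonneg _ (by positivity) (by positivity),
          rpow_add_of_nonneg _ (by positivity) (by positivity), CFC.rpow_one _ hx0]
    _ ≤ τ (x ^ ((p - 1) / 2) * y * x ^ ((p - 1) / 2)) := by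
        refine hτ.mono (mul_mem (mul_mem (rpow_mem hx _) hx) (rpow_mem hx _))
          (mul_mem (mul_mem (rpow_mem hx _) hy) (rpow_mem hx _)) ?_ ?_
        · simpa only [star_rpow] using star_left_conjugate_nonneg hx0 (x ^ ((p - 1) / 2))
        · simpa only [star_rpow] using star_left_conjugate_le_conjugate hxy (x ^ ((p - 1) / 2))
    _ = τ (y ^ (1 / 2 : ℝ) * x ^ (p - 1) * y ^ (1 / 2 : ℝ)) := by
        have h := hτ.tracial (y ^ (1 / 2 : ℝ) * x ^ ((p - 1) / 2))
          (mul_mem (rpow_mem hy _) (rpow_mem hx _))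
        rw [star_mul, star_rpow, star_rpow] at h
        convert h using 2
        · conv_lhs => rw [← hsq]
          noncomm_ring
        · conv_lhs => rw [← rpow_half_mul_self _ hp0]
          noncomm_ring
    _ ≤ τ (y ^ (1 / 2 : ℝ) * y ^ (p - 1) * y ^ (1 / 2 : ℝ)) := by
        have hle : x ^ (p - 1) ≤ y ^ (p - 1) :=
          CFC.rpow_le_rpow ⟨hp0, by linarith⟩ hxy
        refine hτ.mono (mul_mem (mul_mem (rpow_mem hy _) (rpow_mem hx _)) (rpow_mem hy _))
          (mul_mem (mul_mem (rpow_mem hy _) (rpow_mem hy _)) (rpow_mem hy _)) ?_ ?_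
        · simpa only [star_rpow] using
            star_left_conjugate_nonneg (CFC.rpow_nonneg (a := x) (y := p - 1)) (y ^ (1 / 2 : ℝ))
        · simpa only [star_rpow] using star_left_conjugate_le_conjugate hle (y ^ (1 / 2 : ℝ))
    _ = τ (y ^ p) := by
        conv_rhs => rw [e', rpow_add_of_nonneg _ (by positivity) (by positivity),
          rpow_add_of_nonneg _ (by positivity) (by positivity)]

/-- Induction by halving the exponent, as x^p = (x²)^(p/2). Squaring is not operator monotone, but
with w = x^(1/2) y^(1/2) one has x² ≤ ww* and w*w ≤ y², and τ does not distinguish powers of ww*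
from those of w*w. -/
theorem rpow_le_rpow_of_le_two_pow (n : ℕ) : ∀ {x y : H →L[ℂ] H}, x ∈ M → y ∈ M → 0 ≤ x → x ≤ y →
    ∀ {p : ℝ}, 1 ≤ p → p ≤ 2 ^ (n + 1) → τ (x ^ p) ≤ τ (y ^ p) := by
  induction n with
  | zero =>
    intro x y hx hy hx0 hxy p hp hp2
    exact hτ.rpow_le_rpow_of_le_two hx hy hx0 hxy hp (by simpa using hp2)
  | succ n ih =>
    intro x y hx hy hx0 hxy p hp hpn
    by_cases hp2 : p ≤ 2
    · exact hτ.rpow_le_rpow_of_le_two hx hy hx0 hxy hp hp2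
    have hy0 : 0 ≤ y := hx0.trans hxy
    have hq : 1 ≤ p / 2 := by linarith
    have hqn : p / 2 ≤ 2 ^ (n + 1) := by rw [pow_succ] at hpn; linarith
    have hsq : ∀ {a : H →L[ℂ] H}, 0 ≤ a → a ^ (1 / 2 : ℝ) * a ^ (1 / 2 : ℝ) = a := fun ha => by
      rw [rpow_half_mul_self _ zero_le_one, CFC.rpow_one _ ha]
    have hdouble : ∀ {a : H →L[ℂ] H}, 0 ≤ a → a ^ p = (a * a) ^ (p / 2) := fun {a} ha => by
      have : a * a = a ^ (2 : ℝ) := by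
        rw [← rpow_half_mul_self a zero_le_two, div_self two_ne_zero, CFC.rpow_one a ha]
      rw [this, CFC.rpow_rpow_of_exponent_nonneg a 2 (p / 2) zero_le_two (by linarith),
        mul_div_cancel₀ p two_ne_zero]
    have hconj : ∀ {a b c : H →L[ℂ] H}, 0 ≤ a → b ≤ c →
        a ^ (1 / 2 : ℝ) * b * a ^ (1 / 2 : ℝ) ≤ a ^ (1 / 2 : ℝ) * c * a ^ (1 / 2 : ℝ) :=
      fun {a b c} _ hbc => by
        simpa only [star_rpow] using star_left_conjugate_le_conjugate hbc (a ^ (1 / 2 : ℝ))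
    have hself : ∀ {a : H →L[ℂ] H}, 0 ≤ a → a ^ (1 / 2 : ℝ) * a * a ^ (1 / 2 : ℝ) = a * a :=
      fun {a} ha => by
        conv_rhs => rw [← hsq ha]
        conv_lhs => enter [1, 2]; rw [← hsq ha]
        noncomm_ring
    have hsqnn : ∀ {a : H →L[ℂ] H}, 0 ≤ a → 0 ≤ a * a := fun {a} ha => by
      simpa only [ha.isSelfAdjoint.star_eq] using star_mul_self_nonneg a
    set w := x ^ (1 / 2 : ℝ) * y ^ (1 / 2 : ℝ) with hw
    have hwM : w ∈ M := mul_mem (rpow_mem hx _) (rpow_mem hy _)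
    have hstar : star w = y ^ (1 / 2 : ℝ) * x ^ (1 / 2 : ℝ) := by
      rw [hw, star_mul, star_rpow, star_rpow]
    have hw1 : w * star w = x ^ (1 / 2 : ℝ) * y * x ^ (1 / 2 : ℝ) := by
      rw [hstar, hw]
      conv_rhs => rw [← hsq hy0]
      noncomm_ring
    have hw2 : star w * w = y ^ (1 / 2 : ℝ) * x * y ^ (1 / 2 : ℝ) := by
      rw [hstar, hw]
      conv_rhs => rw [← hsq hx0]
      noncomm_ring
    rw [hdouble hx0, hdouble hy0]
    calc τ ((x * x) ^ (p / 2)) ≤ τ ((w * star w) ^ (p / 2)) :=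
          ih (mul_mem hx hx) (mul_mem hwM (star_mem hwM)) (hsqnn hx0)
            (by rw [hw1, ← hself hx0]; exact hconj hx0 hxy) hq hqn
      _ = τ ((star w * w) ^ (p / 2)) := hτ.rpow_mul_star_self hwM hq
      _ ≤ τ ((y * y) ^ (p / 2)) :=
          ih (mul_mem (star_mem hwM) hwM) (mul_mem hy hy) (star_mul_self_nonneg w)
            (by rw [hw2, ← hself hy0]; exact hconj hy0 hxy) hq hqn

/-- Powers are monotone under the trace, although they are not operator monotone. -/
theorem rpow_le_rpow (hx : x ∈ M) (hy : y ∈ M) (hx0 : 0 ≤ x) (hxy : x ≤ y) {p : ℝ}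
    (hp : 0 ≤ p) : τ (x ^ p) ≤ τ (y ^ p) := by
  rcases le_total p 1 with hp1 | hp1
  · exact hτ.mono (rpow_mem hx p) (rpow_mem hy p) CFC.rpow_nonneg (CFC.rpow_le_rpow ⟨hp, hp1⟩ hxy)
  · obtain ⟨n, hn⟩ := pow_unbounded_of_one_lt p one_lt_two
    exact hτ.rpow_le_rpow_of_le_two_pow n hx hy hx0 hxy hp1
      (hn.le.trans (pow_le_pow_right₀ one_le_two n.le_succ))

end IsFNSTrace

end Trace

/-! ### Scalar comparison of x with its Möbius transform -/

section Comparison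

variable {H : Type*} [NormedAddCommGroup H] [InnerProductSpace ℂ H] [CompleteSpace H]
  {M : VonNeumannAlgebra H} {τ : (H →L[ℂ] H) → ℝ≥0∞}

/-- The Möbius function `x ↦ x / (c + k x)`; on operators it is `A ↦ (c A⁻¹ + k)⁻¹`. -/
noncomputable def moebius (c k x : ℝ) : ℝ := x / (c + k * x)

theorem mem_Icc_of_mem_spectrum {a : H →L[ℂ] H} (ha0 : 0 ≤ a) (ha1 : a ≤ 1) {x : ℝ}
    (hx : x ∈ spectrum ℝ a) : x ∈ Set.Icc (0 : ℝ) 1 := by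
  refine ⟨spectrum_nonneg_of_nonneg ha0 hx, ?_⟩
  rw [← map_one (algebraMap ℝ (H →L[ℂ] H))] at ha1
  exact (le_algebraMap_iff_spectrum_le ha0.isSelfAdjoint).1 ha1 x hx

theorem continuousOn_moebius {c k : ℝ} (hc : 0 < c) (hk : 0 ≤ k) :
    ContinuousOn (moebius c k) (Set.Icc 0 1) := by
  refine ContinuousOn.div (by fun_prop) (by fun_prop) fun x hx => ?_
  have := mul_nonneg hk hx.1
  positivity

theorem moebius_nonneg {c k : ℝ} (hc : 0 < c) (hk : 0 ≤ k) {x : ℝ} (hx : 0 ≤ x) :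
    0 ≤ moebius c k x := by
  unfold moebius
  positivity

/-- Transfers a scalar inequality on [0, 1] to traces: functional calculus in `a`, then trace
monotonicity to pass from the Möbius transform of `a` to `b`. -/
theorem IsFNSTrace.rpow_le_of_moebius_le (hτ : IsFNSTrace M τ) {a b : H →L[ℂ] H} (ha : a ∈ M)
    (hb : b ∈ M) (ha0 : 0 ≤ a) (ha1 : a ≤ 1) {c k : ℝ} (hc : 0 < c) (hk : 0 ≤ k)
    (hab : cfc (moebius c k) a ≤ b) {p q : ℝ} (hp : 0 ≤ p) (hq : 0 ≤ q) {r s : ℝ≥0}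
    (h : ∀ x ∈ Set.Icc (0 : ℝ) 1, x ^ p ≤ r * moebius c k x ^ p + s * x ^ q) :
    τ (a ^ p) ≤ r * τ (b ^ p) + s * τ (a ^ q) := by
  have hsp : spectrum ℝ a ⊆ Set.Icc 0 1 := fun x => mem_Icc_of_mem_spectrum ha0 ha1
  have hm : ContinuousOn (moebius c k) (spectrum ℝ a) := (continuousOn_moebius hc hk).mono hsp
  have hmp : ContinuousOn (fun x => moebius c k x ^ p) (spectrum ℝ a) :=
    hm.rpow_const fun _ _ => .inr hp
  have hpc := (Real.continuous_rpow_const hp).continuousOn (s := spectrum ℝ a)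
  have hqc := (Real.continuous_rpow_const hq).continuousOn (s := spectrum ℝ a)
  have hmr : ContinuousOn (fun x => (r : ℝ) • moebius c k x ^ p) (spectrum ℝ a) :=
    hmp.const_smul (r : ℝ)
  have hqs : ContinuousOn (fun x => (s : ℝ) • x ^ q) (spectrum ℝ a) := hqc.const_smul (s : ℝ)
  have hm0 : ∀ x ∈ spectrum ℝ a, 0 ≤ moebius c k x := fun x hx => moebius_nonneg hc hk (hsp hx).1
  have hg0 : 0 ≤ cfc (moebius c k) a := cfc_nonneg hm0
  have hgM : cfc (moebius c k) a ∈ M := cfc_mem ha _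
  have hle : a ^ p ≤ (r : ℝ) • cfc (moebius c k) a ^ p + (s : ℝ) • a ^ q := by
    rw [cfc_rpow_of_nonneg ha0.isSelfAdjoint hp hm hm0, CFC.rpow_eq_cfc_real ha0,
      CFC.rpow_eq_cfc_real ha0, ← cfc_smul _ _ a hmp, ← cfc_smul _ _ a hqc,
      ← cfc_add a _ _ hmr hqs]
    exact cfc_mono (fun x hx => h x (hsp hx)) hpc (hmr.add hqs)
  have hsmulM : ∀ (t : ℝ≥0) {x : H →L[ℂ] H}, x ∈ M → (t : ℝ) • x ∈ M := fun t x hx =>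
    mem_of_commute fun _ hy => (commute_of_mem hx hy).smul_left _
  have hsmul0 : ∀ (t : ℝ≥0) {x : H →L[ℂ] H}, 0 ≤ x → 0 ≤ (t : ℝ) • x := fun t x hx =>
    smul_nonneg t.2 hx
  have hM1 := hsmulM r (rpow_mem hgM p)
  have hM2 := hsmulM s (rpow_mem ha q)
  calc τ (a ^ p) ≤ τ ((r : ℝ) • cfc (moebius c k) a ^ p + (s : ℝ) • a ^ q) :=
        hτ.mono (rpow_mem ha p) (add_mem hM1 hM2) CFC.rpow_nonneg hle
    _ = r * τ (cfc (moebius c k) a ^ p) + s * τ (a ^ q) := by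
        rw [hτ.map_add _ hM1 _ hM2 (hsmul0 r CFC.rpow_nonneg) (hsmul0 s CFC.rpow_nonneg),
          hτ.map_smul r _ (rpow_mem hgM p) CFC.rpow_nonneg,
          hτ.map_smul s _ (rpow_mem ha q) CFC.rpow_nonneg]
    _ ≤ r * τ (b ^ p) + s * τ (a ^ q) := by
        gcongr
        exact hτ.rpow_le_rpow hgM hb hg0 hab hp

theorem rpow_le_moebius_rpow {c k : ℝ} (hc : 0 < c) (hk : 0 ≤ k) {p : ℝ} (hp : 0 ≤ p) {x : ℝ}
    (hx : x ∈ Set.Icc (0 : ℝ) 1) : x ^ p ≤ (c + k) ^ p * moebius c k x ^ p := by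
  rw [← Real.mul_rpow (by positivity) (moebius_nonneg hc hk hx.1)]
  have hkx : 0 ≤ k * x := mul_nonneg hk hx.1
  refine Real.rpow_le_rpow hx.1 ?_ hp
  rw [moebius, mul_div_assoc', le_div_iff₀ (by positivity), mul_comm]
  gcongr
  · exact hx.1
  · nlinarith [hx.2]

/-- Where (k + 1)x ≤ ε the denominator c + kx is at most c + ε. Elsewhere x^p ≤ 1 ≤ ((k + 1)x /
ε)^q, a bound whose constant does not depend on p. -/
theorem rpow_le_moebius_rpow_add {c k ε : ℝ} (hc : 0 < c) (hk : 0 ≤ k) (hε : 0 < ε) {p q : ℝ}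
    (hp : 0 ≤ p) (hq : 0 ≤ q) {x : ℝ} (hx : x ∈ Set.Icc (0 : ℝ) 1) :
    x ^ p ≤ (c + ε) ^ p * moebius c k x ^ p + ((k + 1) / ε) ^ q * x ^ q := by
  have hkx : 0 ≤ k * x := mul_nonneg hk hx.1
  have hx0 := hx.1
  have hm := moebius_nonneg hc hk hx.1
  by_cases h : (k + 1) * x ≤ ε
  · refine le_add_of_le_of_nonneg ?_ (by positivity)
    rw [← Real.mul_rpow (by positivity) hm]
    refine Real.rpow_le_rpow hx.1 ?_ hp
    rw [moebius, mul_div_assoc', le_div_iff₀ (by positivity), mul_comm]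
    gcongr
    linarith
  · refine le_add_of_nonneg_of_le (by positivity) ?_
    rw [← Real.mul_rpow (by positivity) hx.1]
    refine (Real.rpow_le_one hx.1 hx.2 hp).trans (Real.one_le_rpow ?_ hq)
    rw [div_mul_eq_mul_div, one_le_div hε]
    exact (not_le.1 h).le

end Comparison

/-! ### Bounded perturbations and the inverse of T² + 1 -/

section Operators

variable {H : Type*} [NormedAddCommGroup H] [InnerProductSpace ℂ H]

theorem mem_graph_addBounded {T : H →ₗ.[ℂ] H} {C : H →L[ℂ] H} {x z : H} :
    (x, z) ∈ (addBounded T C).graph ↔ (x, z - C x) ∈ T.graph := by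
  simp only [LinearPMap.mem_graph_iff]
  constructor
  · rintro ⟨u, rfl, hu⟩
    exact ⟨u, rfl, eq_sub_of_add_eq' hu⟩
  · rintro ⟨u, rfl, hu⟩
    exact ⟨u, rfl, (eq_sub_iff_add_eq'.1 hu)⟩

theorem addBounded_addBounded_neg (T : H →ₗ.[ℂ] H) (C : H →L[ℂ] H) :
    addBounded (addBounded T C) (-C) = T := by
  refine LinearPMap.eq_of_eq_graph (Submodule.ext ?_)
  rintro ⟨x, z⟩
  rw [mem_graph_addBounded, mem_graph_addBounded, neg_apply, sub_neg_eq_add,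
    add_sub_cancel_right]

variable [CompleteSpace H] {T : H →ₗ.[ℂ] H}

theorem graph_adjoint_of_isSelfAdjoint (hT : IsSelfAdjoint T) : T.graph.adjoint = T.graph := by
  rw [← LinearPMap.adjoint_graph_eq_graph_adjoint hT.dense_domain,
    LinearPMap.isSelfAdjoint_def.1 hT]

theorem inner_eq_of_mem_graph (hT : IsSelfAdjoint T) {a b c d : H} (h1 : (a, b) ∈ T.graph)
    (h2 : (c, d) ∈ T.graph) : inner ℂ b c = inner ℂ a d := by
  rw [← graph_adjoint_of_isSelfAdjoint hT, Submodule.mem_adjoint_iff] at h2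
  exact sub_eq_zero.1 (h2 a b h1)

theorem isSelfAdjoint_addBounded (hT : IsSelfAdjoint T) {C : H →L[ℂ] H} (hC : IsSelfAdjoint C) :
    IsSelfAdjoint (addBounded T C) := by
  have hd : Dense ((addBounded T C).domain : Set H) := hT.dense_domain
  rw [LinearPMap.isSelfAdjoint_def]
  refine LinearPMap.eq_of_eq_graph ?_
  rw [LinearPMap.adjoint_graph_eq_graph_adjoint hd]
  ext ⟨u, v⟩
  rw [mem_graph_addBounded, ← graph_adjoint_of_isSelfAdjoint hT, Submodule.mem_adjoint_iff,
    Submodule.mem_adjoint_iff]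
  have hCi : ∀ a : H, inner ℂ (C a) u = inner ℂ a (C u) := fun a => by
    rw [← ContinuousLinearMap.adjoint_inner_right, hC.adjoint_eq]
  constructor
  · intro h a b hab
    have := h a (b + C a) (by rw [mem_graph_addBounded]; simpa using hab)
    simp only [inner_add_left, inner_sub_right, hCi] at this ⊢
    linear_combination this
  · intro h a b hab
    have := h a (b - C a) (mem_graph_addBounded.1 hab)
    simp only [inner_sub_left, inner_sub_right, hCi] at this ⊢
    linear_combination this

theorem inner_eq_of_mem_graph_sqAddOne (hT : IsSelfAdjoint T) {x y z : H}
    (h1 : (x, z) ∈ T.graph) (h2 : (z, y - x) ∈ T.graph) :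
    inner ℂ x y = ((‖x‖ ^ 2 + ‖z‖ ^ 2 : ℝ) : ℂ) := by
  have h := inner_eq_of_mem_graph hT h1 h2
  rw [inner_sub_right, inner_self_eq_norm_sq_to_K, inner_self_eq_norm_sq_to_K] at h
  push_cast
  simp only [Complex.coe_algebraMap] at h
  linear_combination -h

theorem IsBoundedInverse.nonneg (hT : IsSelfAdjoint T) {A : H →L[ℂ] H}
    (hA : IsBoundedInverse (sqAddOne T) A) : 0 ≤ A := by
  rw [ContinuousLinearMap.nonneg_iff_isPositive, ContinuousLinearMap.isPositive_iff_complex]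
  intro y
  obtain ⟨z, h1, h2⟩ := mem_graph_sqAddOne.1 ((hA _ y).2 rfl)
  rw [inner_eq_of_mem_graph_sqAddOne hT h1 h2]
  exact ⟨rfl, by rw [RCLike.re_eq_complex_re, Complex.ofReal_re]; positivity⟩

/-- With x = Ay and z = Tx one has y - x = Tz, so ⟨y - x, y⟩ = ‖z‖² + ‖y - x‖² ≥ 0. -/
theorem IsBoundedInverse.le_one (hT : IsSelfAdjoint T) {A : H →L[ℂ] H}
    (hA : IsBoundedInverse (sqAddOne T) A) : A ≤ 1 := by
  rw [ContinuousLinearMap.le_def, ContinuousLinearMap.isPositive_iff_complex]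
  intro y
  obtain ⟨z, h1, h2⟩ := mem_graph_sqAddOne.1 ((hA _ y).2 rfl)
  have h3 := inner_eq_of_mem_graph hT h2 h1
  have h4 : inner ℂ ((1 - A) y) y = ((‖z‖ ^ 2 + ‖y - A y‖ ^ 2 : ℝ) : ℂ) := by
    have : inner ℂ (y - A y) y = inner ℂ (y - A y) (A y) + inner ℂ (y - A y) (y - A y) := by
      rw [← inner_add_right, add_sub_cancel]
    rw [sub_apply, one_apply_eq_self, this, h3,
      inner_self_eq_norm_sq_to_K, inner_self_eq_norm_sq_to_K]
    push_cast
    rfl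
  rw [h4]
  exact ⟨rfl, by rw [RCLike.re_eq_complex_re, Complex.ofReal_re]; positivity⟩

theorem IsBoundedInverse.mem {M : VonNeumannAlgebra H} (hTM : IsAffiliated M T) {A : H →L[ℂ] H}
    (hA : IsBoundedInverse (sqAddOne T) A) : A ∈ M := by
  refine mem_of_commute fun y hy => ?_
  ext v
  obtain ⟨z, h1, h2⟩ := mem_graph_sqAddOne.1 ((hA _ v).2 rfl)
  have h3 := hTM y hy _ _ h2
  rw [map_sub] at h3
  exact (hA _ _).1 (mem_graph_sqAddOne.2 ⟨y z, hTM y hy _ _ h1, h3⟩)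

theorem isAffiliated_addBounded {M : VonNeumannAlgebra H} (hTM : IsAffiliated M T)
    {C : H →L[ℂ] H} (hC : C ∈ M) : IsAffiliated M (addBounded T C) := by
  intro y hy x z h
  rw [mem_graph_addBounded] at h ⊢
  have h' := hTM y hy _ _ h
  have hc : C (y x) = y (C x) := congrArg (fun f : H →L[ℂ] H => f x) (commute_of_mem hC hy).eq
  rwa [map_sub, ← hc] at h'

/-- The form inequality `(T + C)² + 1 ≤ (1 + ε) (T² + 1) + (1 + ε⁻¹) ‖C‖²`, in terms of the
inverses. -/
theorem moebius_le_of_isBoundedInverse (hT : IsSelfAdjoint T) {C : H →L[ℂ] H}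
    (hC : IsSelfAdjoint C) {A B : H →L[ℂ] H} (hA : IsBoundedInverse (sqAddOne T) A)
    (hB : IsBoundedInverse (sqAddOne (addBounded T C)) B) {ε : ℝ} (hε : 0 < ε) :
    cfc (moebius (1 + ε) ((1 + ε⁻¹) * ‖C‖ ^ 2)) A ≤ B := by
  set k := (1 + ε⁻¹) * ‖C‖ ^ 2 with hk
  have hk0 : 0 ≤ k := by positivity
  have hS := isSelfAdjoint_addBounded hT hC
  have hA0 := hA.nonneg hT
  have hsp : spectrum ℝ A ⊆ Set.Icc 0 1 := fun x => mem_Icc_of_mem_spectrum hA0 (hA.le_one hT)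
  have hpos : ∀ x ∈ spectrum ℝ A, 0 < 1 + ε + k * x := fun x hx => by
    have := mul_nonneg hk0 (hsp hx).1
    positivity
  -- Factoring G = AW puts every vector Gv in the range of A, that is, in the domain of T², where
  -- the forms can be evaluated.
  set W := cfc (fun x : ℝ => (1 + ε + k * x)⁻¹) A with hW
  set G := cfc (moebius (1 + ε) k) A with hG
  have hc : ContinuousOn (fun x : ℝ => (1 + ε + k * x)⁻¹) (spectrum ℝ A) :=
    ContinuousOn.inv₀ (by fun_prop) fun x hx => (hpos x hx).ne'
  have hAW : A * W = G := by
    conv_lhs => enter [1]; rw [← cfc_id ℝ A hA0.isSelfAdjoint]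
    rw [hW, ← cfc_mul _ _ A continuousOn_id hc, hG]
    exact cfc_congr fun x _ => rfl
  have hone : (1 + ε) • W + k • G = 1 := by
    have hm : ContinuousOn (moebius (1 + ε) k) (spectrum ℝ A) :=
      (continuousOn_moebius (by positivity) hk0).mono hsp
    have hc' : ContinuousOn (fun x => (1 + ε) • (1 + ε + k * x)⁻¹) (spectrum ℝ A) :=
      hc.const_smul (1 + ε)
    have hm' : ContinuousOn (fun x => k • moebius (1 + ε) k x) (spectrum ℝ A) := hm.const_smul k
    rw [hW, hG, ← cfc_smul _ _ A hc, ← cfc_smul _ _ A hm, ← cfc_add A _ _ hc' hm',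
      ← cfc_one ℝ A hA0.isSelfAdjoint]
    refine cfc_congr fun x hx => ?_
    have := (hpos x hx).ne'
    simp only [moebius, smul_eq_mul, Pi.one_apply]
    field_simp
  have hG0 : 0 ≤ G := cfc_nonneg fun x hx => moebius_nonneg (by positivity) hk0 (hsp hx).1
  rw [ContinuousLinearMap.le_def, ContinuousLinearMap.isPositive_def']
  refine ⟨(hB.nonneg hS).isSelfAdjoint.sub hG0.isSelfAdjoint, fun v => ?_⟩
  rw [ContinuousLinearMap.reApplyInnerSelf_apply, sub_apply, inner_sub_left,
    map_sub, sub_nonneg]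
  have hu : A (W v) = G v := by rw [← hAW]; rfl
  have hv : v = (1 + ε) • W v + k • G v := by
    conv_lhs => rw [← one_apply_eq_self (F := H →L[ℂ] H) v, ← hone]
    rfl
  obtain ⟨z, h1, h2⟩ := mem_graph_sqAddOne.1 ((hA _ _).2 hu)
  obtain ⟨t, h3, h4⟩ := mem_graph_sqAddOne.1 ((hB _ v).2 rfl)
  have h5 : (G v, z + C (G v)) ∈ (addBounded T C).graph := by
    rw [mem_graph_addBounded]
    simpa using h1
  set u := G v
  set b := B v
  have e1 : RCLike.re (inner ℂ u v) = (1 + ε) * (‖u‖ ^ 2 + ‖z‖ ^ 2) + k * ‖u‖ ^ 2 := by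
    conv_lhs => rw [hv]
    rw [inner_add_right, inner_smul_right_eq_smul, inner_smul_right_eq_smul, map_add,
      inner_eq_of_mem_graph_sqAddOne hT h1 h2, RCLike.smul_re, RCLike.smul_re,
      inner_self_eq_norm_sq, RCLike.re_eq_complex_re, Complex.ofReal_re]
  have e2 : RCLike.re (inner ℂ b v) = ‖b‖ ^ 2 + ‖t‖ ^ 2 := by
    rw [inner_eq_of_mem_graph_sqAddOne hS h3 h4, RCLike.re_eq_complex_re, Complex.ofReal_re]
  have e3 : RCLike.re (inner ℂ u v) =
      RCLike.re (inner ℂ u b) + RCLike.re (inner ℂ (z + C u) t) := by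
    rw [inner_eq_of_mem_graph hS h5 h4, inner_sub_right, map_sub, add_sub_cancel]
  have i1 := re_inner_le_norm (𝕜 := ℂ) u b
  have i2 := re_inner_le_norm (𝕜 := ℂ) (z + C u) t
  have i3 : ‖z + C u‖ ≤ ‖z‖ + ‖C‖ * ‖u‖ :=
    (norm_add_le _ _).trans (add_le_add_right (C.le_opNorm u) _)
  have i4 : ‖z + C u‖ ^ 2 ≤ (1 + ε) * ‖z‖ ^ 2 + k * ‖u‖ ^ 2 := by
    refine (pow_le_pow_left₀ (norm_nonneg _) i3 2).trans ?_
    have : (1 + ε) * ‖z‖ ^ 2 + k * ‖u‖ ^ 2 - (‖z‖ + ‖C‖ * ‖u‖) ^ 2 =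
        ε⁻¹ * (ε * ‖z‖ - ‖C‖ * ‖u‖) ^ 2 := by
      rw [hk]
      field_simp
      ring
    have : 0 ≤ ε⁻¹ * (ε * ‖z‖ - ‖C‖ * ‖u‖) ^ 2 := by positivity
    linarith
  -- Write S = T + C, so that Su = z + Cu. By `e3` and Young's inequality, 2 re⟨u, v⟩ ≤ ‖u‖² + ‖Su‖²
  -- + ‖b‖² + ‖t‖². The first two terms are at most re⟨u, v⟩ by `i4` and `e1`, and the last two
  -- equal re⟨b, v⟩ by `e2`.
  nlinarith [sq_nonneg (‖u‖ - ‖b‖), sq_nonneg (‖z + C u‖ - ‖t‖), mul_nonneg hε.le (sq_nonneg ‖u‖)]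

end Operators

/-! ### Comparison of the zeta functions and their residues -/

section Zeta

variable {H : Type*} [NormedAddCommGroup H] [InnerProductSpace ℂ H] [CompleteSpace H]
  {M : VonNeumannAlgebra H} {τ : (H →L[ℂ] H) → ℝ≥0∞} {T : H →ₗ.[ℂ] H} {C : H →L[ℂ] H}

theorem zeta_le_mul_zeta_addBounded (hτ : IsFNSTrace M τ) (hT : IsSelfAdjoint T)
    (hTM : IsAffiliated M T) (hCM : C ∈ M) (hC : IsSelfAdjoint C) {s : ℝ} (hs : 0 ≤ s) :
    ∃ r : ℝ≥0, zeta τ T s ≤ r * zeta τ (addBounded T C) s := by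
  obtain ⟨A, hA⟩ := exists_isBoundedInverse_sqAddOne hT
  obtain ⟨B, hB⟩ := exists_isBoundedInverse_sqAddOne (isSelfAdjoint_addBounded hT hC)
  have hk : 0 ≤ (1 + 1⁻¹) * ‖C‖ ^ 2 := by positivity
  rw [zeta, zeta, hA.boundedInverse_eq, hB.boundedInverse_eq]
  refine ⟨⟨((1 + 1 : ℝ) + (1 + 1⁻¹) * ‖C‖ ^ 2) ^ (s / 2), by positivity⟩, ?_⟩
  -- The additive term is switched off by the coefficient 0: even if τ(A^0) = τ(1) is infinite, 0 *
  -- ∞ = 0 in `ℝ≥0∞`.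
  have h := hτ.rpow_le_of_moebius_le (hA.mem hTM) (hB.mem (isAffiliated_addBounded hTM hCM))
    (hA.nonneg hT) (hA.le_one hT) (by norm_num) hk
    (moebius_le_of_isBoundedInverse hT hC hA hB one_pos) (p := s / 2) (q := 0) (by positivity)
    le_rfl (r := ⟨((1 + 1 : ℝ) + (1 + 1⁻¹) * ‖C‖ ^ 2) ^ (s / 2), by positivity⟩) (s := 0)
    (fun x hx => by
      rw [NNReal.coe_zero, zero_mul, add_zero]
      exact rpow_le_moebius_rpow (by norm_num) hk (by positivity) hx)
  simpa using h

theorem zeta_le_add_mul_zeta_addBounded (hτ : IsFNSTrace M τ) (hT : IsSelfAdjoint T)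
    (hTM : IsAffiliated M T) (hCM : C ∈ M) (hC : IsSelfAdjoint C) {ε : ℝ} (hε : 0 < ε) {q : ℝ}
    (hq : 0 ≤ q) (hfin : zeta τ T q ≠ ∞) :
    ∃ N : ℝ≥0, ∀ s : ℝ, 0 ≤ s →
      zeta τ T s ≤ N + ENNReal.ofReal ((1 + ε) ^ s) * zeta τ (addBounded T C) s := by
  obtain ⟨A, hA⟩ := exists_isBoundedInverse_sqAddOne hT
  obtain ⟨B, hB⟩ := exists_isBoundedInverse_sqAddOne (isSelfAdjoint_addBounded hT hC)
  have hk : 0 ≤ (1 + ε⁻¹) * ‖C‖ ^ 2 := by positivity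
  simp only [zeta, hA.boundedInverse_eq, hB.boundedInverse_eq] at hfin ⊢
  let N : ℝ≥0 := ⟨(((1 + ε⁻¹) * ‖C‖ ^ 2 + 1) / ε) ^ (q / 2), by positivity⟩
  refine ⟨N * (τ (A ^ (q / 2))).toNNReal, fun s hs => ?_⟩
  rw [ENNReal.coe_mul, ENNReal.coe_toNNReal hfin, add_comm]
  refine hτ.rpow_le_of_moebius_le (hA.mem hTM) (hB.mem (isAffiliated_addBounded hTM hCM))
    (hA.nonneg hT) (hA.le_one hT) (by positivity) hk
    (moebius_le_of_isBoundedInverse hT hC hA hB hε) (p := s / 2) (q := q / 2) (by positivity)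
    (by positivity) (r := ((1 + ε) ^ s).toNNReal) (s := N) (fun x hx => ?_)
  have h := rpow_le_moebius_rpow_add (c := 1 + ε) (by positivity) hk hε (p := s / 2)
    (by positivity) (q := q / 2) (by positivity) hx
  refine h.trans (add_le_add_left (mul_le_mul_of_nonneg_right ?_ ?_) _)
  · rw [Real.coe_toNNReal _ (by positivity)]
    -- The scalar lemma yields the factor (1 + 2ε)^(s/2), and 1 + 2ε ≤ (1 + ε)².
    have : (1 + ε) ^ s = ((1 + ε) ^ 2) ^ (s / 2) := by
      rw [← Real.rpow_natCast, ← Real.rpow_mul (by positivity)]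
      congr 1
      push_cast
      ring
    rw [this]
    exact Real.rpow_le_rpow (by positivity) (by nlinarith) (by positivity)
  · exact Real.rpow_nonneg (moebius_nonneg (by positivity) hk hx.1) _

theorem zeta_ne_top_iff (hτ : IsFNSTrace M τ) (hT : IsSelfAdjoint T) (hTM : IsAffiliated M T)
    (hCM : C ∈ M) (hC : IsSelfAdjoint C) {s : ℝ} (hs : 0 ≤ s) :
    zeta τ T s ≠ ∞ ↔ zeta τ (addBounded T C) s ≠ ∞ := by
  constructor
  · intro h
    obtain ⟨r, hr⟩ := zeta_le_mul_zeta_addBounded hτ (isSelfAdjoint_addBounded hT hC)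
      (isAffiliated_addBounded hTM hCM) (neg_mem hCM) hC.neg hs
    rw [addBounded_addBounded_neg] at hr
    exact ne_top_of_le_ne_top (ENNReal.mul_ne_top ENNReal.coe_ne_top h) hr
  · intro h
    obtain ⟨r, hr⟩ := zeta_le_mul_zeta_addBounded hτ hT hTM hCM hC hs
    exact ne_top_of_le_ne_top (ENNReal.mul_ne_top ENNReal.coe_ne_top h) hr

-- The hypotheses squeeze (s - d) g(s) between (1 + ε)^(-s) (s - d)(f(s) - N) and (s - d)N' + (1 +
-- ε)^s (s - d) f(s). Their limits (1 + ε)^(∓d) a tend to a as ε → 0, so ε is fixed first, according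
-- to the target bound, and only then s → d+.
open Filter Topology in
theorem tendsto_sub_mul_of_le {f g : ℝ → ℝ} {d a : ℝ}
    (hfg : ∀ ε > 0, ∃ N : ℝ, ∀ s > d, f s ≤ N + (1 + ε) ^ s * g s)
    (hgf : ∀ ε > 0, ∃ N : ℝ, ∀ s > d, g s ≤ N + (1 + ε) ^ s * f s)
    (hf : Tendsto (fun s => (s - d) * f s) (𝓝[>] d) (𝓝 a)) :
    Tendsto (fun s => (s - d) * g s) (𝓝[>] d) (𝓝 a) := by
  have hid : Tendsto (fun s : ℝ => s) (𝓝[>] d) (𝓝 d) :=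
    tendsto_nhdsWithin_of_tendsto_nhds tendsto_id
  have hsub : ∀ N : ℝ, Tendsto (fun s : ℝ => (s - d) * N) (𝓝[>] d) (𝓝 0) := fun N => by
    simpa using (hid.sub_const d).mul_const N
  have hpow : ∀ ε > 0, ∀ c : ℝ, Tendsto (fun s : ℝ => (1 + ε : ℝ) ^ (c * s)) (𝓝[>] d)
      (𝓝 ((1 + ε) ^ (c * d))) := fun ε hε c =>
    (Real.continuousAt_const_rpow (by positivity)).tendsto.comp (hid.const_mul c)
  have hlim : ∀ c : ℝ, Tendsto (fun ε : ℝ => (1 + ε) ^ (c * d) * a) (𝓝[>] 0) (𝓝 a) := fun c => by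
    have h0 : ContinuousAt (fun ε : ℝ => (1 + ε) ^ (c * d) * a) 0 :=
      ((continuousAt_const.add continuousAt_id).rpow_const (.inl (by norm_num))).mul
        continuousAt_const
    have := h0.tendsto.mono_left (nhdsWithin_le_nhds (s := Set.Ioi 0))
    simpa using this
  refine tendsto_order.2 ⟨fun b hb => ?_, fun b hb => ?_⟩
  · obtain ⟨ε, hεb, hε⟩ :=
      (((tendsto_order.1 (hlim (-1))).1 b hb).and self_mem_nhdsWithin).exists
    obtain ⟨N, hN⟩ := hfg ε hε
    have hl := (hpow ε hε (-1)).mul (hf.sub (hsub N))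
    rw [sub_zero] at hl
    filter_upwards [(tendsto_order.1 hl).1 b hεb, self_mem_nhdsWithin] with s hs hsd
    refine hs.trans_le ?_
    have hp : 0 < (1 + ε) ^ s := Real.rpow_pos_of_pos (add_pos one_pos hε) s
    rw [neg_one_mul, Real.rpow_neg (add_pos one_pos hε).le, inv_mul_le_iff₀ hp]
    have := mul_le_mul_of_nonneg_left (hN s hsd) (sub_pos.2 hsd).le
    linear_combination this
  · obtain ⟨ε, hεb, hε⟩ :=
      (((tendsto_order.1 (hlim 1)).2 b hb).and self_mem_nhdsWithin).exists
    obtain ⟨N, hN⟩ := hgf ε hε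
    have hl := (hsub N).add ((hpow ε hε 1).mul hf)
    rw [zero_add] at hl
    filter_upwards [(tendsto_order.1 hl).2 b hεb, self_mem_nhdsWithin] with s hs hsd
    refine lt_of_le_of_lt ?_ hs
    rw [one_mul]
    have := mul_le_mul_of_nonneg_left (hN s hsd) (sub_pos.2 hsd).le
    linear_combination this

theorem exists_toReal_zeta_le (hτ : IsFNSTrace M τ) (hT : IsSelfAdjoint T)
    (hTM : IsAffiliated M T) (hCM : C ∈ M) (hC : IsSelfAdjoint C) {d : ℝ} (hd : 0 ≤ d)
    (h : ∀ s, d < s → zeta τ T s ≠ ∞) {ε : ℝ} (hε : 0 < ε) :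
    ∃ N : ℝ, ∀ s > d,
      (zeta τ T s).toReal ≤ N + (1 + ε) ^ s * (zeta τ (addBounded T C) s).toReal := by
  -- Any reference exponent beyond d would serve; d + 1 is one at which ζ_T is finite.
  obtain ⟨N, hN⟩ := zeta_le_add_mul_zeta_addBounded hτ hT hTM hCM hC hε (by positivity)
    (h (d + 1) (lt_add_one d))
  refine ⟨N, fun s hs => ?_⟩
  have hs0 : 0 ≤ s := hd.trans hs.le
  have hfin := (zeta_ne_top_iff hτ hT hTM hCM hC hs0).1 (h s hs)
  have hmul := ENNReal.mul_ne_top (ENNReal.ofReal_ne_top (r := (1 + ε) ^ s)) hfin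
  have := ENNReal.toReal_mono (ENNReal.add_ne_top.2 ⟨ENNReal.coe_ne_top, hmul⟩) (hN s hs0)
  rwa [ENNReal.toReal_add ENNReal.coe_ne_top hmul, ENNReal.toReal_mul, ENNReal.coe_toReal,
    ENNReal.toReal_ofReal (by positivity)] at this

theorem hasResidue_addBounded (hτ : IsFNSTrace M τ) (hT : IsSelfAdjoint T)
    (hTM : IsAffiliated M T) (hCM : C ∈ M) (hC : IsSelfAdjoint C) {d α : ℝ} (hd : 0 ≤ d)
    (h : HasResidue (zeta τ T) d α) : HasResidue (zeta τ (addBounded T C)) d α := by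
  have hfin : ∀ s, d < s → zeta τ (addBounded T C) s ≠ ∞ := fun s hs =>
    (zeta_ne_top_iff hτ hT hTM hCM hC (hd.trans hs.le)).1 (h.1 s hs)
  refine ⟨hfin, tendsto_sub_mul_of_le
    (fun ε hε => exists_toReal_zeta_le hτ hT hTM hCM hC hd h.1 hε) (fun ε hε => ?_) h.2⟩
  have := exists_toReal_zeta_le hτ (isSelfAdjoint_addBounded hT hC)
    (isAffiliated_addBounded hTM hCM) (neg_mem hCM) hC.neg hd hfin hε
  rwa [addBounded_addBounded_neg] at this

end Zeta

end Semifinite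

theorem mainTheorem9 {H : Type*} [NormedAddCommGroup H] [InnerProductSpace ℂ H] [CompleteSpace H]
    (M : VonNeumannAlgebra H) (τ : (H →L[ℂ] H) → ℝ≥0∞) (hτ : Semifinite.IsFNSTrace M τ)
    (T : H →ₗ.[ℂ] H) (hT : IsSelfAdjoint T) (hTM : Semifinite.IsAffiliated M T)
    (hTc : Semifinite.HasTauCompactResolvent M τ T)
    (C : H →L[ℂ] H) (hCM : C ∈ M) (hC : IsSelfAdjoint C) :
    (∀ d α : ℝ, 0 ≤ d →
      (Semifinite.HasResidue (Semifinite.zeta τ T) d α ↔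
        Semifinite.HasResidue (Semifinite.zeta τ (Semifinite.addBounded T C)) d α)) ∧
    Semifinite.abscissa (Semifinite.zeta τ T) =
      Semifinite.abscissa (Semifinite.zeta τ (Semifinite.addBounded T C)) := by
  -- `hTc` is not used: if `zeta τ T q` is finite for a single `q`, then this value already bounds
  -- the contribution of the spectrum of `(T ^ 2 + 1)⁻¹` away from `0`.
  refine ⟨fun d α hd => ⟨Semifinite.hasResidue_addBounded hτ hT hTM hCM hC hd, fun h => ?_⟩, ?_⟩
  · have := Semifinite.hasResidue_addBounded hτ (Semifinite.isSelfAdjoint_addBounded hT hC)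
      (Semifinite.isAffiliated_addBounded hTM hCM) (neg_mem hCM) hC.neg hd h
    rwa [Semifinite.addBounded_addBounded_neg] at this
  · rw [Semifinite.abscissa, Semifinite.abscissa]
    congr 2
    ext s
    exact and_congr_right fun hs => Semifinite.zeta_ne_top_iff hτ hT hTM hCM hC hs.le
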